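/- Notation. On $\mathbb{C}^n$ use $\langle x,y\rangle=\sum_i \bar x_i y_i$. For $z\in\mathbb{C}^n$ and $s\ge 1$ let $z_s$ be the vector that keeps $s$ largest entries of $z$ in modulus (all entries if $s\ge n$) and is zero elsewhere, let $z_{\bar s}=z-z_s$, and let $\sigma_s(z)=\inf\{\|z-w\|_{\ell_1}: w \text{ has at most } s \text{ nonzero entries}\}$. A matrix $A\in\mathbb{C}^{m\times n}$ has the robust null space property of order $s$ with parameters $\rho,\tau$ if $$\|z_s\|_{\ell_2}\le \frac{\rho}{\sqrt s}\|z_{\bar s}\|_{\ell_1}+\tau\|Az\|_{\ell_2}\quad\text{for all } z\in\mathbb{C}^n \text{ with } \|z\|_{\ell_2}=1 .$$ A random vector $a\in\mathbb{C}^n$ is isotropic if $\mathbb{E}|\langle a,z\rangle|^2=\|z\|_{\ell_2}^2$ for all $z$, incoherent if $\max_{1\le k\le n}|\langle e_k,a\rangle|^2=1$ almost surely, and obeys the fourth-moment bound with constant $C_4$ if $\mathbb{E}|\langle a,z\rangle|^4\le C_4\|z\|_{\ell_2}^4$ for all $z$. Theorem. There are an absolute constant $K>0$ and numbers $D_1,D_2>0$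 depending only on $\rho\in(0,1)$, and for every $C_4>0$ there are constants $C,\tilde c>0$ depending only on $C_4$, such that the following holds. Fix $\rho\in(0,1)$, integers $s\ge 1$, $n\ge 1$, and $m\ge C\rho^{-2}s\log n$. Let $a\in\mathbb{C}^n$ be an isotropic, incoherent random vector that obeys the fourth-moment bound with constant $C_4$, let $a_1,\dots,a_m$ be independent copies of $a$, and let $A$ be the $m\times n$ matrix with $(Az)_i=\langle a_i,z\rangle$. Then, with probability at least $1-2e^{-\tilde c m}$, the matrix $A$ has the robust null space property of order $s$ with parameters $\rho$ and $\tau=K/\sqrt m$, and, simultaneously for all $x\in\mathbb{C}^n$, all $\eta\ge 0$ and all $e\in\mathbb{C}^m$ with $\|e\|_{\ell_2}\le\eta$, every solution $z^\sharp$ of the basis pursuit denoising problem $$\text{minimize } \|z\|_{\ell_1}\quad\text{subject to } \|Az-y\|_{\ell_2}\le\eta,\qquad y=Ax+e,$$ obeys $$\|x-z^\sharp\|_{\ell_2}\le \frac{D_1}{\sqrt s}\,\sigma_s(x)+D_2\frac{\eta}{\sqrt m}.$$ -/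

import Mathlib

open MeasureTheory ProbabilityTheory

noncomputable section

namespace SparseRecovery

/-- Complex `n`-space with its Euclidean norm and the inner product
`⟪x, y⟫ = ∑ i, conj (x i) * y i` (conjugate-linear in the first argument). -/
abbrev Vec (n : ℕ) := EuclideanSpace ℂ (Fin n)

section RandomVector

variable {Ω : Type*} [MeasurableSpace Ω] {n : ℕ}

/-- Isotropy: `𝔼 |⟪a, z⟫|² = ‖z‖²` for all `z`. -/
def Isotropic (a : Ω → Vec n) (P : Measure Ω) : Prop :=
  ∀ z : Vec n, ∫ ω, ‖inner ℂ (a ω) z‖ ^ 2 ∂P = ‖z‖ ^ 2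

/-- Incoherence: `max_k |⟪e_k, a⟫|² = 1` almost surely. -/
def Incoherent (a : Ω → Vec n) (P : Measure Ω) : Prop :=
  ∀ᵐ ω ∂P, (⨆ k : Fin n, ‖inner ℂ (EuclideanSpace.single k (1 : ℂ)) (a ω)‖ ^ 2) = 1

/-- Fourth-moment bound with constant `C₄`: `𝔼 |⟪a, z⟫|⁴ ≤ C₄ ‖z‖⁴` for all `z`. -/
def FourthMomentBound (C₄ : ℝ) (a : Ω → Vec n) (P : Measure Ω) : Prop :=
  ∀ z : Vec n, Integrable (fun ω => ‖inner ℂ (a ω) z‖ ^ 4) P ∧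
    ∫ ω, ‖inner ℂ (a ω) z‖ ^ 4 ∂P ≤ C₄ * ‖z‖ ^ 4

end RandomVector

/-- The `m × n` matrix whose `i`-th measurement is `(A z)_i = ⟪a_i, z⟫`, so that its `i`-th row
is the conjugate transpose of `a_i`. -/
def measurementMatrix {m n : ℕ} (a : Fin m → Vec n) : Matrix (Fin m) (Fin n) ℂ :=
  Matrix.of fun i j => star (a i j)

/-- The vector `A z` in Euclidean space. -/
def apply {m n : ℕ} (A : Matrix (Fin m) (Fin n) ℂ) (z : Vec n) : Vec m :=
  WithLp.toLp 2 (A.mulVec z.ofLp)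

/-- The `ℓ₁` norm. -/
def l1norm {n : ℕ} (z : Vec n) : ℝ := ∑ i, ‖z i‖

/-- `z` has at most `s` nonzero entries. -/
def IsSparse {n : ℕ} (s : ℕ) (z : Vec n) : Prop :=
  (Finset.univ.filter fun i => z i ≠ 0).card ≤ s

/-- The `ℓ₁` error `σ_s(x)` of the best approximation of `x` by `s`-sparse vectors. -/
def sparseError {n : ℕ} (s : ℕ) (x : Vec n) : ℝ :=
  ⨅ z : {z : Vec n // IsSparse s z}, l1norm (x - (z : Vec n))

/-- The vector that keeps the entries of `z` in `S` and has all other entries set to zero. -/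
def restrict {n : ℕ} (S : Finset (Fin n)) (z : Vec n) : Vec n :=
  WithLp.toLp 2 fun i => if i ∈ S then z i else 0

/-- `S` is a set of positions of `s` largest entries of `z` in modulus
(all positions, if `s` exceeds `n`). -/
def IsLargest {n : ℕ} (s : ℕ) (z : Vec n) (S : Finset (Fin n)) : Prop :=
  S.card = min s n ∧ ∀ i ∈ S, ∀ j ∉ S, ‖z j‖ ≤ ‖z i‖

/-- Robust null space property of order `s` with parameters `ρ` and `τ`:
`‖z_s‖₂ ≤ (ρ / √s) ‖z - z_s‖₁ + τ ‖A z‖₂` on the unit sphere, where `z_s` keeps the `s` largest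
entries of `z`. Both norms do not depend on how ties are broken. -/
def RobustNSP {m n : ℕ} (s : ℕ) (ρ τ : ℝ) (A : Matrix (Fin m) (Fin n) ℂ) : Prop :=
  ∀ z : Vec n, ‖z‖ = 1 → ∀ S : Finset (Fin n), IsLargest s z S →
    ‖restrict S z‖ ≤ ρ / √(s : ℝ) * l1norm (restrict Sᶜ z) + τ * ‖apply A z‖

/-- `z♯` solves basis pursuit denoising: it minimizes `‖z‖₁` subject to `‖A z - y‖₂ ≤ η`. -/
def IsBPDNSolution {m n : ℕ} (A : Matrix (Fin m) (Fin n) ℂ) (y : Vec m) (η : ℝ)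
    (zs : Vec n) : Prop :=
  ‖apply A zs - y‖ ≤ η ∧ ∀ z : Vec n, ‖apply A z - y‖ ≤ η → l1norm zs ≤ l1norm z

end SparseRecovery

end

noncomputable section

namespace SparseRecovery

/-! ### Best sparse approximation, and recovery from the null space property. -/

section Deterministic

variable {m n : ℕ}

/-! If the null space inequality fails at a unit vector `z`, then `‖z‖₁ ≤ 2√s/ρ` and `‖Az‖ < √m/2`,
so it suffices to bound `‖Az‖` below on the unit vectors of an `ℓ₁`-ball. That set is reduced to a
finite one by Maurey's argument: entries of the `a_i` are at most 1 in modulus, so `‖Au‖ ≤ √m ‖u‖₁`,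
and an average of `N ~ s/ρ²` vertices of a polytope approximates `z` both in `ℓ₂` and in `‖A·‖/√m`
(`exists_vertexAverage_near`). The average chosen depends on `A`, but the list of at most `(4n)^N`
candidates does not.

For a fixed vector, `‖Az‖²` is a sum of independent nonnegative terms, and the lower tail of such a
sum needs only second moments of the terms, here fourth moments of `a` (`measure_sum_lt_half_le`).
The failure probability `exp(-m/(8C₄))` survives a union bound over the candidates because `m`
dominates `C₄ N log(4n)`; then `robustNSP_of_vertexAverage` concludes. Recovery follows
deterministically from the null space property (`RobustNSP.bpdn_error_le`). -/

theorem apply_eq_toEuclideanLin (A : Matrix (Fin m) (Fin n) ℂ) (z : Vec n) :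
    apply A z = Matrix.toEuclideanLin A z := rfl

theorem norm_restrict_sq (S : Finset (Fin n)) (z : Vec n) :
    ‖restrict S z‖ ^ 2 = ∑ i ∈ S, ‖z i‖ ^ 2 := by
  rw [EuclideanSpace.norm_sq_eq, ← Finset.sum_filter_add_sum_filter_not _ (· ∈ S)]
  rw [Finset.sum_congr rfl (g := fun i => ‖z i‖ ^ 2),
    Finset.sum_eq_zero (s := Finset.univ.filter (· ∉ S))]
  · simp
  · intro i hi
    simp [restrict, (Finset.mem_filter.1 hi).2]
  · intro i hi
    simp [restrict, (Finset.mem_filter.1 hi).2]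

theorem l1norm_restrict (S : Finset (Fin n)) (z : Vec n) :
    l1norm (restrict S z) = ∑ i ∈ S, ‖z i‖ := by
  rw [l1norm, ← Finset.sum_filter_add_sum_filter_not _ (· ∈ S)]
  rw [Finset.sum_congr rfl (g := fun i => ‖z i‖),
    Finset.sum_eq_zero (s := Finset.univ.filter (· ∉ S))]
  · simp
  · intro i hi
    simp [restrict, (Finset.mem_filter.1 hi).2]
  · intro i hi
    simp [restrict, (Finset.mem_filter.1 hi).2]

theorem l1norm_nonneg (z : Vec n) : 0 ≤ l1norm z := Finset.sum_nonneg fun _ _ => norm_nonneg _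

theorem l1norm_restrict_add_compl (S : Finset (Fin n)) (z : Vec n) :
    l1norm (restrict S z) + l1norm (restrict Sᶜ z) = l1norm z := by
  rw [l1norm_restrict, l1norm_restrict, Finset.sum_add_sum_compl, l1norm]

theorem norm_restrict_sq_add_compl (S : Finset (Fin n)) (z : Vec n) :
    ‖restrict S z‖ ^ 2 + ‖restrict Sᶜ z‖ ^ 2 = ‖z‖ ^ 2 := by
  rw [norm_restrict_sq, norm_restrict_sq, Finset.sum_add_sum_compl, EuclideanSpace.norm_sq_eq]

theorem restrict_smul (S : Finset (Fin n)) (c : ℂ) (z : Vec n) :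
    restrict S (c • z) = c • restrict S z := by
  ext i
  simp [restrict]

theorem l1norm_smul (c : ℂ) (z : Vec n) : l1norm (c • z) = ‖c‖ * l1norm z := by
  simp [l1norm, Finset.mul_sum]

theorem l1norm_add_le (z w : Vec n) : l1norm (z + w) ≤ l1norm z + l1norm w := by
  rw [l1norm, l1norm, l1norm, ← Finset.sum_add_distrib]
  exact Finset.sum_le_sum fun i _ => norm_add_le _ _

theorem norm_le_l1norm (z : Vec n) : ‖z‖ ≤ l1norm z := by
  refine abs_le_of_sq_le_sq' ?_ (l1norm_nonneg z) |>.2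
  rw [EuclideanSpace.norm_sq_eq]
  exact Finset.sum_sq_le_sq_sum_of_nonneg fun i _ => norm_nonneg _

/-- Greedy choice: adjoining a largest remaining entry preserves domination over the complement. -/
theorem exists_isLargest (s : ℕ) (z : Vec n) : ∃ S, IsLargest s z S := by
  suffices h : ∀ k ≤ n, ∃ S : Finset (Fin n), S.card = k ∧ ∀ i ∈ S, ∀ j ∉ S, ‖z j‖ ≤ ‖z i‖ from
    h _ (min_le_right _ _)
  intro k
  induction k with
  | zero => exact fun _ => ⟨∅, by simp⟩
  | succ k ih =>
    intro hk
    obtain ⟨S, hc, hS⟩ := ih (by omega)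
    have hne : Sᶜ.Nonempty := by
      rw [← Finset.card_pos, Finset.card_compl, Fintype.card_fin]
      omega
    obtain ⟨b, hb, hmax⟩ := Finset.exists_max_image Sᶜ (fun i => ‖z i‖) hne
    rw [Finset.mem_compl] at hb
    refine ⟨insert b S, by rw [Finset.card_insert_of_notMem hb, hc], fun i hi j hj => ?_⟩
    rw [Finset.mem_insert, not_or] at hj
    rcases Finset.mem_insert.1 hi with rfl | hi
    · exact hmax j (Finset.mem_compl.2 hj.2)
    · exact hS i hi j hj.2

/-- The sum of `f` over a set of `s` largest positions dominates the sum over any set of at most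
`s` positions. -/
theorem IsLargest.sum_le {s : ℕ} {z : Vec n} {L : Finset (Fin n)} (hL : IsLargest s z L)
    {S : Finset (Fin n)} (hS : S.card ≤ s) {g : ℝ → ℝ} (hg : MonotoneOn g (Set.Ici 0))
    (hg0 : ∀ t, 0 ≤ t → 0 ≤ g t) :
    ∑ i ∈ S, g ‖z i‖ ≤ ∑ i ∈ L, g ‖z i‖ := by
  have hcard : (S \ L).card ≤ (L \ S).card := by
    have h1 := Finset.card_sdiff_add_card_inter S L
    have h2 := Finset.card_sdiff_add_card_inter L S
    rw [Finset.inter_comm] at h2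
    have h3 : S.card ≤ n := by simpa using Finset.card_le_univ S
    have h4 := hL.1
    have h5 : S.card ≤ min s n := le_min hS h3
    omega
  have key : ∑ i ∈ S \ L, g ‖z i‖ ≤ ∑ i ∈ L \ S, g ‖z i‖ := by
    rcases (S \ L).eq_empty_or_nonempty with he | hne
    · rw [he, Finset.sum_empty]
      exact Finset.sum_nonneg fun i _ => hg0 _ (norm_nonneg _)
    -- `‖z b‖` is a threshold: values on `S \ L` lie below it, values on `L \ S` above.
    obtain ⟨b, hb, hmax⟩ := Finset.exists_max_image (S \ L) (fun i => ‖z i‖) hne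
    calc ∑ i ∈ S \ L, g ‖z i‖ ≤ (S \ L).card • g ‖z b‖ :=
          Finset.sum_le_card_nsmul _ _ _ fun i hi => hg (norm_nonneg _) (norm_nonneg _) (hmax i hi)
      _ ≤ (L \ S).card • g ‖z b‖ := nsmul_le_nsmul_left (hg0 _ (norm_nonneg _)) hcard
      _ ≤ ∑ i ∈ L \ S, g ‖z i‖ :=
          Finset.card_nsmul_le_sum _ _ _ fun i hi => hg (norm_nonneg _) (norm_nonneg _)
            (hL.2 i (Finset.mem_sdiff.1 hi).1 b (Finset.mem_sdiff.1 hb).2)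
  have h1 := Finset.sum_inter_add_sum_sdiff S L (fun i => g ‖z i‖)
  have h2 := Finset.sum_inter_add_sum_sdiff L S (fun i => g ‖z i‖)
  rw [Finset.inter_comm] at h2
  linarith

theorem IsLargest.norm_restrict_le {s : ℕ} {z : Vec n} {L : Finset (Fin n)}
    (hL : IsLargest s z L) {S : Finset (Fin n)} (hS : S.card ≤ s) :
    ‖restrict S z‖ ≤ ‖restrict L z‖ := by
  refine abs_le_of_sq_le_sq' ?_ (norm_nonneg _) |>.2
  rw [norm_restrict_sq, norm_restrict_sq]
  exact hL.sum_le hS (g := fun t => t ^ 2) (fun a ha b _ hab => pow_le_pow_left₀ ha hab 2)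
    fun t _ => sq_nonneg t

theorem IsLargest.l1norm_restrict_compl_le {s : ℕ} {z : Vec n} {L : Finset (Fin n)}
    (hL : IsLargest s z L) {S : Finset (Fin n)} (hS : S.card ≤ s) :
    l1norm (restrict Lᶜ z) ≤ l1norm (restrict Sᶜ z) := by
  have h := hL.sum_le hS (g := id) (fun a _ b _ hab => hab) fun t ht => ht
  have h1 := l1norm_restrict_add_compl S z
  have h2 := l1norm_restrict_add_compl L z
  simp only [id] at h
  rw [← l1norm_restrict, ← l1norm_restrict] at h
  linarith

theorem l1norm_restrict_le_sqrt {s : ℕ} {S : Finset (Fin n)} (hS : S.card ≤ s) (z : Vec n) :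
    l1norm (restrict S z) ≤ √(s : ℝ) * ‖restrict S z‖ := by
  refine abs_le_of_sq_le_sq' ?_ (by positivity) |>.2
  rw [mul_pow, Real.sq_sqrt (Nat.cast_nonneg _), l1norm_restrict, norm_restrict_sq]
  exact sq_sum_le_card_mul_sum_sq.trans
    (mul_le_mul_of_nonneg_right (by exact_mod_cast hS)
      (Finset.sum_nonneg fun i _ => sq_nonneg _))

/-- Stechkin's estimate for the tail of a vector. -/
theorem IsLargest.norm_restrict_compl_le {s : ℕ} (hs : 1 ≤ s) {z : Vec n} {L : Finset (Fin n)}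
    (hL : IsLargest s z L) : ‖restrict Lᶜ z‖ ≤ l1norm z / √(s : ℝ) := by
  have hs' : (0 : ℝ) < s := by exact_mod_cast hs
  have hz := l1norm_nonneg z
  refine abs_le_of_sq_le_sq' ?_ (by positivity) |>.2
  rw [div_pow, Real.sq_sqrt hs'.le, norm_restrict_sq]
  rcases le_or_gt n s with hn | hn
  · have : Lᶜ = ∅ := by
      rw [← Finset.card_eq_zero, Finset.card_compl, Fintype.card_fin, hL.1]
      omega
    rw [this, Finset.sum_empty]
    positivity
  have hcard : L.card = s := by rw [hL.1]; omega
  -- An entry outside `L` is at most the average over the `s` entries in `L`.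
  have hle : ∀ j ∈ Lᶜ, ‖z j‖ ≤ l1norm z / s := by
    intro j hj
    rw [le_div_iff₀ hs', mul_comm, ← hcard, ← nsmul_eq_mul]
    have h := Finset.card_nsmul_le_sum L (fun i => ‖z i‖) ‖z j‖ fun i hi =>
      hL.2 i hi j (Finset.mem_compl.1 hj)
    exact h.trans (Finset.sum_le_univ_sum_of_nonneg fun i => norm_nonneg _)
  calc ∑ i ∈ Lᶜ, ‖z i‖ ^ 2 ≤ ∑ i ∈ Lᶜ, l1norm z / s * ‖z i‖ :=
        Finset.sum_le_sum fun i hi => by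
          rw [sq]; exact mul_le_mul_of_nonneg_right (hle i hi) (norm_nonneg _)
    _ = l1norm z / s * ∑ i ∈ Lᶜ, ‖z i‖ := by rw [Finset.mul_sum]
    _ ≤ l1norm z / s * l1norm z :=
        mul_le_mul_of_nonneg_left (Finset.sum_le_univ_sum_of_nonneg fun i => norm_nonneg _)
          (by positivity)
    _ = l1norm z ^ 2 / s := by ring

/-- Both sides are homogeneous in `z`, so the normalization to the unit sphere can be dropped. -/
theorem RobustNSP.norm_restrict_le {s : ℕ} {ρ τ : ℝ} {A : Matrix (Fin m) (Fin n) ℂ}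
    (hA : RobustNSP s ρ τ A) (z : Vec n) {L : Finset (Fin n)} (hL : IsLargest s z L) :
    ‖restrict L z‖ ≤ ρ / √(s : ℝ) * l1norm (restrict Lᶜ z) + τ * ‖apply A z‖ := by
  rcases eq_or_ne z 0 with rfl | hz
  · have h0 (S : Finset (Fin n)) : restrict S (0 : Vec n) = 0 := by ext i; simp [restrict]
    simp [h0, l1norm, apply_eq_toEuclideanLin]
  have hz' : 0 < ‖z‖ := norm_pos_iff.2 hz
  set c : ℂ := ((‖z‖⁻¹ : ℝ) : ℂ) with hc
  have hcn : ‖c‖ = ‖z‖⁻¹ := by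
    rw [hc, Complex.norm_real, Real.norm_of_nonneg (inv_nonneg.2 hz'.le)]
  have h := hA (c • z) (by rw [norm_smul, hcn, inv_mul_cancel₀ hz'.ne']) L
    ⟨hL.1, fun i hi j hj => by
      simpa [norm_smul] using mul_le_mul_of_nonneg_left (hL.2 i hi j hj) (norm_nonneg c)⟩
  rw [restrict_smul, restrict_smul, l1norm_smul, apply_eq_toEuclideanLin, map_smul, norm_smul,
    norm_smul, hcn, ← apply_eq_toEuclideanLin] at h
  have h' := mul_le_mul_of_nonneg_left h hz'.le
  field_simp at h' ⊢
  linarith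

/-- Robust null space property implies stable and robust recovery via basis pursuit denoising. -/
theorem RobustNSP.bpdn_error_le {s : ℕ} (hs : 1 ≤ s) {ρ τ : ℝ} (hρ : 0 < ρ) (hρ1 : ρ < 1)
    (hτ : 0 ≤ τ) {A : Matrix (Fin m) (Fin n) ℂ} (hA : RobustNSP s ρ τ A) {x : Vec n}
    {e : Vec m} {η : ℝ} (he : ‖e‖ ≤ η) {zs : Vec n} (hzs : IsBPDNSolution A (apply A x + e) η zs) :
    ‖x - zs‖ ≤ 8 / (1 - ρ) / √(s : ℝ) * sparseError s x
      + (4 / (1 - ρ) + 3) * (τ * (2 * η)) := by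
  have hs' : (0 : ℝ) < √(s : ℝ) := Real.sqrt_pos.2 (by exact_mod_cast hs)
  have hρ' : 0 < 1 - ρ := by linarith
  have hmin : l1norm zs ≤ l1norm x := hzs.2 x (by simpa using he)
  set v := zs - x with hv
  have hAv : ‖apply A v‖ ≤ 2 * η := by
    have : apply A v = (apply A zs - (apply A x + e)) + e := by
      rw [hv, apply_eq_toEuclideanLin, map_sub, apply_eq_toEuclideanLin, apply_eq_toEuclideanLin]
      abel
    rw [this]
    linarith [norm_add_le (apply A zs - (apply A x + e)) e, hzs.1]
  set b := τ * (2 * η) with hb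
  have hτb : τ * ‖apply A v‖ ≤ b := mul_le_mul_of_nonneg_left hAv hτ
  have hb0 : 0 ≤ b := le_trans (by positivity) hτb
  obtain ⟨L, hL⟩ := exists_isLargest s v
  have hLv := hA.norm_restrict_le v hL
  -- Two index sets interact: the support `S` of `w`, natural for `ℓ₁`-minimality, and the largest
  -- entries `L` of the error `v`, where the null space property applies. Maximality of `L` passes
  -- between them.
  have hbound : ∀ w : Vec n, IsSparse s w →
      ‖v‖ ≤ 8 / (1 - ρ) / √(s : ℝ) * l1norm (x - w) + (4 / (1 - ρ) + 3) * b := by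
    intro w hw
    set S : Finset (Fin n) := Finset.univ.filter fun i => w i ≠ 0 with hS
    set p := l1norm (restrict S v)
    set q := l1norm (restrict Sᶜ v)
    set σ := l1norm (x - w)
    have hq0 : 0 ≤ q := l1norm_nonneg _
    have hσ0 : 0 ≤ σ := l1norm_nonneg _
    have hpq : p + q = l1norm v := l1norm_restrict_add_compl S v
    have hσ : l1norm (restrict Sᶜ x) ≤ σ := by
      rw [l1norm_restrict]
      calc ∑ i ∈ Sᶜ, ‖x i‖ = ∑ i ∈ Sᶜ, ‖(x - w) i‖ := Finset.sum_congr rfl fun i hi => by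
            have : w i = 0 := by simpa [hS] using hi
            simp [this]
        _ ≤ σ := Finset.sum_le_univ_sum_of_nonneg fun i => norm_nonneg _
    -- Cone condition: minimality of `zs` prevents the error from having much more mass off `S` than
    -- on it.
    have h1 : q ≤ p + 2 * σ := by
      have hx := l1norm_restrict_add_compl S x
      have hz := l1norm_restrict_add_compl S zs
      have e1 : l1norm (restrict S x) ≤ l1norm (restrict S zs) + p := by
        simp only [p, l1norm_restrict, ← Finset.sum_add_distrib]
        refine Finset.sum_le_sum fun i _ => ?_
        have : x i = zs i - v i := by simp [hv]
        rw [this]; exact norm_sub_le _ _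
      have e2 : q ≤ l1norm (restrict Sᶜ zs) + l1norm (restrict Sᶜ x) := by
        simp only [q, l1norm_restrict, ← Finset.sum_add_distrib]
        refine Finset.sum_le_sum fun i _ => ?_
        simpa [hv] using norm_sub_le (zs i) (x i)
      linarith
    have h2 : ‖restrict L v‖ ≤ ρ / √(s : ℝ) * q + b :=
      hLv.trans (add_le_add (mul_le_mul_of_nonneg_left (hL.l1norm_restrict_compl_le hw)
        (by positivity)) hτb)
    have h3 : p ≤ ρ * q + √(s : ℝ) * b := by
      have := (l1norm_restrict_le_sqrt hw v).trans
        (mul_le_mul_of_nonneg_left ((hL.norm_restrict_le hw).trans h2) hs'.le)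
      rw [mul_add] at this
      refine this.trans (le_of_eq ?_)
      field_simp
    have h4 : q ≤ (2 * σ + √(s : ℝ) * b) / (1 - ρ) := by
      rw [le_div_iff₀ hρ']; linarith
    have h5 : l1norm v ≤ 2 * q + √(s : ℝ) * b := by nlinarith
    have h6 := hL.norm_restrict_compl_le hs
    have h7 : ‖v‖ ≤ ‖restrict L v‖ + ‖restrict Lᶜ v‖ := by
      refine abs_le_of_sq_le_sq' ?_ (by positivity) |>.2
      rw [← norm_restrict_sq_add_compl L v]
      nlinarith [norm_nonneg (restrict L v), norm_nonneg (restrict Lᶜ v)]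
    have h8 : ρ / √(s : ℝ) * q ≤ q / √(s : ℝ) := by
      rw [div_mul_eq_mul_div]
      exact div_le_div_of_nonneg_right (by nlinarith) hs'.le
    have h9 : l1norm v / √(s : ℝ) ≤ 2 * (q / √(s : ℝ)) + b := by
      rw [div_le_iff₀ hs']
      refine h5.trans (le_of_eq ?_)
      field_simp
    have h10 : q / √(s : ℝ) ≤ 2 / (1 - ρ) / √(s : ℝ) * σ + 1 / (1 - ρ) * b := by
      rw [div_le_iff₀ hs']
      refine h4.trans (le_of_eq ?_)
      field_simp
    have h11 : 0 ≤ 2 / (1 - ρ) / √(s : ℝ) * σ := by positivity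
    have h12 : 0 ≤ 1 / (1 - ρ) * b := by positivity
    have e1 : 8 / (1 - ρ) / √(s : ℝ) * σ = 4 * (2 / (1 - ρ) / √(s : ℝ) * σ) := by ring
    have e2 : (4 / (1 - ρ) + 3) * b = 4 * (1 / (1 - ρ) * b) + 3 * b := by ring
    linarith
  rw [norm_sub_rev]
  set D := 8 / (1 - ρ) / √(s : ℝ) with hD
  have hD0 : 0 < D := by positivity
  have : Nonempty {z : Vec n // IsSparse s z} := ⟨⟨0, by simp [IsSparse]⟩⟩
  have : (‖v‖ - (4 / (1 - ρ) + 3) * b) / D ≤ sparseError s x := by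
    refine le_ciInf fun w => ?_
    rw [div_le_iff₀ hD0]
    linarith [hbound w w.2]
  rw [div_le_iff₀ hD0] at this
  linarith

end Deterministic

/-! ### Maurey sparsification in the complex `ℓ₁`-ball. -/

section Sparsification

open scoped InnerProductSpace

/-- Greedy form of Maurey's sparsification: if no half-space separates `z` from the vectors `v i`,
then averages of `N` of these vectors approximate `z` with accuracy `D / √N`. -/
theorem exists_sum_sub_nsmul_norm_sq_le {H ι : Type*} [NormedAddCommGroup H]
    [InnerProductSpace ℂ H] {v : ι → H} {z : H} {D : ℝ} (hD : ∀ i, ‖v i - z‖ ^ 2 ≤ D)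
    (h : ∀ w : H, ∃ i, (⟪w, v i - z⟫_ℂ).re ≤ 0) (N : ℕ) :
    ∃ f : Fin N → ι, ‖∑ j, v (f j) - N • z‖ ^ 2 ≤ N * D := by
  induction N with
  | zero => exact ⟨Fin.elim0, by simp⟩
  | succ N ih =>
    obtain ⟨f, hf⟩ := ih
    -- The new vertex has nonpositive correlation with the accumulated error, so the squared error
    -- grows by at most `D`.
    obtain ⟨i, hi⟩ := h (∑ j, v (f j) - N • z)
    refine ⟨Fin.cons i f, ?_⟩
    have e : ∑ j, v ((Fin.cons i f : Fin (N + 1) → ι) j) - (N + 1) • z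
        = (∑ j, v (f j) - N • z) + (v i - z) := by
      rw [Fin.sum_univ_succ]
      simp only [Fin.cons_zero, Fin.cons_succ, add_smul, one_smul]
      abel
    rw [e, @norm_add_sq ℂ]
    have := hD i
    push_cast
    simp only [RCLike.re_to_complex]
    linarith

variable {m n : ℕ}

/-- The vertex `2 R i ^ p e_k`, for `q = (k, p)`, of a polytope containing the complex
`ℓ₁`-ball of radius `R`. -/
def vertex (R : ℝ) (q : Fin n × Fin 4) : Vec n :=
  EuclideanSpace.single q.1 (2 * (R : ℂ) * Complex.I ^ (q.2 : ℕ))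

theorem l1norm_vertex {R : ℝ} (hR : 0 ≤ R) (q : Fin n × Fin 4) :
    l1norm (vertex R q) = 2 * R := by
  rw [l1norm, Finset.sum_eq_single q.1]
  · simp [vertex, abs_of_nonneg hR]
  · intro j _ hj
    simp [vertex, hj]
  · simp

/-- Some quarter turn has real part `-max(|re c|, |im c|)`, which is at most `-‖c‖/2`. The lost
factor 2 is why the vertices have size `2R`. -/
theorem exists_re_I_pow_mul_le (c : ℂ) : ∃ p : Fin 4, 2 * (Complex.I ^ (p : ℕ) * c).re ≤ -‖c‖ := by
  have h := Complex.norm_le_abs_re_add_abs_im c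
  have h2 : Complex.I ^ 2 = -1 := Complex.I_sq
  have h3 : Complex.I ^ 3 = -Complex.I := Complex.I_pow_three
  rcases le_total |c.re| |c.im| with hc | hc
  · rcases abs_cases c.im with h' | h'
    · exact ⟨1, by simp; linarith⟩
    · exact ⟨3, by simp [h3]; linarith⟩
  · rcases abs_cases c.re with h' | h'
    · exact ⟨2, by simp [h2]; linarith⟩
    · exact ⟨0, by simp; linarith⟩

/-- No half-space separates a point of the `ℓ₁`-ball from the vertices. -/
theorem exists_re_inner_vertex_le {H : Type*} [NormedAddCommGroup H] [InnerProductSpace ℂ H]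
    (hn : 1 ≤ n) (Φ : Vec n →ₗ[ℂ] H) {R : ℝ} {z : Vec n} (hz : l1norm z ≤ R) (w : H) :
    ∃ q, (⟪w, Φ (vertex R q) - Φ z⟫_ℂ).re ≤ 0 := by
  have : NeZero n := ⟨by omega⟩
  have hR : 0 ≤ R := (l1norm_nonneg z).trans hz
  set c : Fin n → ℂ := fun k => ⟪w, Φ (EuclideanSpace.single k 1)⟫_ℂ with hc
  obtain ⟨k, -, hk⟩ := Finset.exists_max_image Finset.univ (fun k => ‖c k‖) Finset.univ_nonempty
  obtain ⟨p, hp⟩ := exists_re_I_pow_mul_le (c k)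
  refine ⟨(k, p), ?_⟩
  have hΦ : ⟪w, Φ z⟫_ℂ = ∑ i, z i * c i := by
    have hz : z = ∑ i, z i • (EuclideanSpace.single i (1 : ℂ) : Vec n) := by
      simpa using ((EuclideanSpace.basisFun (Fin n) ℂ).sum_repr z).symm
    conv_lhs => rw [hz]
    simp only [map_sum, map_smul, inner_sum, inner_smul_right, hc]
  have hv : ⟪w, Φ (vertex R (k, p))⟫_ℂ = ((2 * R : ℝ) : ℂ) * (Complex.I ^ (p : ℕ) * c k) := by
    have : vertex R (k, p) = (2 * (R : ℂ) * Complex.I ^ (p : ℕ)) •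
        (EuclideanSpace.single k (1 : ℂ) : Vec n) := by
      ext j
      simp [vertex]
    rw [this, map_smul, inner_smul_right]
    push_cast
    ring
  have hlow : -(R * ‖c k‖) ≤ (⟪w, Φ z⟫_ℂ).re := by
    have h1 : ‖⟪w, Φ z⟫_ℂ‖ ≤ R * ‖c k‖ := by
      rw [hΦ]
      calc ‖∑ i, z i * c i‖ ≤ ∑ i, ‖z i * c i‖ := norm_sum_le _ _
        _ ≤ ∑ i, ‖z i‖ * ‖c k‖ := Finset.sum_le_sum fun i _ => by
            rw [norm_mul]
            exact mul_le_mul_of_nonneg_left (hk i (Finset.mem_univ _)) (norm_nonneg _)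
        _ = l1norm z * ‖c k‖ := by rw [← Finset.sum_mul, l1norm]
        _ ≤ R * ‖c k‖ := mul_le_mul_of_nonneg_right hz (norm_nonneg _)
    exact (abs_le.1 ((Complex.abs_re_le_norm _).trans h1)).1
  rw [inner_sub_right, hv, Complex.sub_re, Complex.re_ofReal_mul]
  nlinarith

/-- The measurement matrix evaluates inner products. -/
theorem apply_measurementMatrix (a : Fin m → Vec n) (z : Vec n) (i : Fin m) :
    apply (measurementMatrix a) z i = ⟪a i, z⟫_ℂ := by
  simp [apply, measurementMatrix, Matrix.mulVec, dotProduct, PiLp.inner_apply, mul_comm]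

theorem norm_apply_sq (a : Fin m → Vec n) (z : Vec n) :
    ‖apply (measurementMatrix a) z‖ ^ 2 = ∑ i, ‖⟪a i, z⟫_ℂ‖ ^ 2 := by
  simp [EuclideanSpace.norm_sq_eq, apply_measurementMatrix]

theorem norm_inner_le_l1norm {b : Vec n} (hb : ∀ k, ‖b k‖ ≤ 1) (z : Vec n) :
    ‖⟪b, z⟫_ℂ‖ ≤ l1norm z := by
  rw [PiLp.inner_apply]
  refine (norm_sum_le _ _).trans (Finset.sum_le_sum fun k _ => ?_)
  refine (norm_inner_le_norm _ _).trans ?_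
  exact mul_le_of_le_one_left (norm_nonneg _) (hb k)

theorem norm_apply_sq_le {a : Fin m → Vec n} (ha : ∀ i k, ‖a i k‖ ≤ 1) (z : Vec n) :
    ‖apply (measurementMatrix a) z‖ ^ 2 ≤ m * l1norm z ^ 2 := by
  rw [norm_apply_sq]
  refine (Finset.sum_le_card_nsmul _ _ (l1norm z ^ 2) fun i _ => ?_).trans (by simp)
  exact pow_le_pow_left₀ (norm_nonneg _) (norm_inner_le_l1norm (ha i) z) 2

/-- The average of the vertices with indices `f`. -/
def vertexAverage {N : ℕ} (R : ℝ) (f : Fin N → Fin n × Fin 4) : Vec n :=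
  ((N : ℂ)⁻¹) • ∑ j, vertex R (f j)

/-- Points of the `ℓ₁`-ball are approximated by averages of `N` vertices, simultaneously in
Euclidean norm and in the seminorm `‖A z‖ / √m`. -/
theorem exists_vertexAverage_near (hn : 1 ≤ n) (hm : 1 ≤ m) {a : Fin m → Vec n}
    (ha : ∀ i k, ‖a i k‖ ≤ 1) {R : ℝ} {z : Vec n} (hz : l1norm z ≤ R) {N : ℕ} (hN : 1 ≤ N) :
    ∃ f : Fin N → Fin n × Fin 4, ‖vertexAverage R f - z‖ ^ 2 ≤ 18 * R ^ 2 / N ∧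
      ‖apply (measurementMatrix a) (vertexAverage R f - z)‖ ^ 2 ≤ m * (18 * R ^ 2 / N) := by
  have hR : 0 ≤ R := (l1norm_nonneg z).trans hz
  have hm' : (0 : ℝ) < m := by exact_mod_cast hm
  have hN' : (0 : ℝ) < N := by exact_mod_cast hN
  set A := measurementMatrix a with hA
  -- The map `u ↦ (u, Au/√m)` merges both norms into one Hilbert norm, so a single `f` serves for
  -- both.
  set Φ : Vec n →ₗ[ℂ] WithLp 2 (Vec n × Vec m) :=
    (WithLp.linearEquiv 2 ℂ (Vec n × Vec m)).symm.toLinearMap ∘ₗ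
      LinearMap.prod LinearMap.id (((√(m : ℝ) : ℝ) : ℂ)⁻¹ • Matrix.toEuclideanLin A) with hΦdef
  have hΦ (u : Vec n) : ‖Φ u‖ ^ 2 = ‖u‖ ^ 2 + ‖apply A u‖ ^ 2 / m := by
    rw [WithLp.prod_norm_sq_eq_of_L2]
    have h1 : (Φ u).fst = u := rfl
    have h2 : (Φ u).snd = ((√(m : ℝ) : ℝ) : ℂ)⁻¹ • apply A u := rfl
    rw [h1, h2, norm_smul, mul_pow, norm_inv, Complex.norm_real,
      Real.norm_of_nonneg (Real.sqrt_nonneg _), inv_pow, Real.sq_sqrt hm'.le]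
    ring
  have hΦle (u : Vec n) : ‖Φ u‖ ^ 2 ≤ 2 * l1norm u ^ 2 := by
    have h1 : ‖apply A u‖ ^ 2 / m ≤ l1norm u ^ 2 := by
      rw [div_le_iff₀ hm', mul_comm]; exact norm_apply_sq_le ha u
    have h2 := pow_le_pow_left₀ (norm_nonneg u) (norm_le_l1norm u) 2
    rw [hΦ]; linarith
  -- `18 R² = 2 (3R)²`: a vertex and `z` are within `2R + R` in `ℓ₁`.
  obtain ⟨f, hf⟩ := exists_sum_sub_nsmul_norm_sq_le (v := fun q => Φ (vertex R q)) (z := Φ z)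
    (D := 18 * R ^ 2) (fun q => by
      rw [← map_sub]
      refine (hΦle _).trans ?_
      have h1 := l1norm_add_le (vertex R q) ((-1 : ℂ) • z)
      rw [l1norm_smul, l1norm_vertex hR] at h1
      have h2 : vertex R q - z = vertex R q + (-1 : ℂ) • z := by simp [sub_eq_add_neg]
      have h3 : l1norm (vertex R q - z) ≤ 3 * R := by
        rw [h2]
        refine h1.trans ?_
        rw [norm_neg, norm_one]
        linarith
      have := pow_le_pow_left₀ (l1norm_nonneg _) h3 2
      linarith)
    (fun w => exists_re_inner_vertex_le hn Φ hz w) N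
  have hs : ∑ j, Φ (vertex R (f j)) - N • Φ z = (N : ℂ) • Φ (vertexAverage R f - z) := by
    have hNC : (N : ℂ) ≠ 0 := by exact_mod_cast hN'.ne'
    rw [map_sub, vertexAverage, map_smul, smul_sub, smul_smul, mul_inv_cancel₀ hNC, one_smul,
      map_sum, Nat.cast_smul_eq_nsmul]
  rw [hs, norm_smul, mul_pow, Complex.norm_natCast, hΦ] at hf
  have hf' : ‖vertexAverage R f - z‖ ^ 2 + ‖apply A (vertexAverage R f - z)‖ ^ 2 / m
      ≤ 18 * R ^ 2 / N := by
    rw [le_div_iff₀ hN']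
    refine le_of_mul_le_mul_left (le_trans (le_of_eq (by ring)) hf) hN'
  have h0 : 0 ≤ ‖apply A (vertexAverage R f - z)‖ ^ 2 / m := by positivity
  refine ⟨f, by linarith, ?_⟩
  rw [← div_le_iff₀' hm']
  linarith [sq_nonneg ‖vertexAverage R f - z‖]

end Sparsification

/-! ### One-sided Laplace transform bounds. -/

/-- `(1 - x + x²/2)(1 + x + x²/2) = 1 + x⁴/4 ≥ 1`, and the second factor is at most `exp x`. -/
theorem exp_neg_le_quadratic {x : ℝ} (hx : 0 ≤ x) : Real.exp (-x) ≤ 1 - x + x ^ 2 / 2 := by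
  have h := Real.quadratic_le_exp_of_nonneg hx
  have hp : 0 < 1 - x + x ^ 2 / 2 := by nlinarith [sq_nonneg (x - 1)]
  rw [Real.exp_neg, inv_le_iff_one_le_mul₀ (Real.exp_pos x)]
  calc (1 : ℝ) ≤ (1 - x + x ^ 2 / 2) * (1 + x + x ^ 2 / 2) := by nlinarith [sq_nonneg (x ^ 2)]
    _ ≤ _ := mul_le_mul_of_nonneg_left h hp.le

/-- Laplace transform of a nonnegative random variable with finite second moment. -/
theorem mgf_neg_le {Ω : Type*} [MeasurableSpace Ω] {P : Measure Ω} [IsProbabilityMeasure P]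
    {Y : Ω → ℝ} (hY0 : ∀ ω, 0 ≤ Y ω) (hY : AEMeasurable Y P)
    (hY2 : Integrable (fun ω => Y ω ^ 2) P) {l : ℝ} (hl : 0 ≤ l) :
    mgf Y P (-l) ≤ Real.exp (-(l * ∫ ω, Y ω ∂P) + l ^ 2 / 2 * ∫ ω, Y ω ^ 2 ∂P) := by
  have hLp : MemLp Y 2 P := (memLp_two_iff_integrable_sq hY.aestronglyMeasurable).2 hY2
  have hY1 : Integrable Y P := hLp.integrable (by norm_num)
  have hi : Integrable (fun ω => 1 - l * Y ω + l ^ 2 / 2 * Y ω ^ 2) P :=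
    ((integrable_const _).sub (hY1.const_mul _)).add (hY2.const_mul _)
  calc mgf Y P (-l) ≤ ∫ ω, (1 - l * Y ω + l ^ 2 / 2 * Y ω ^ 2) ∂P := by
        refine integral_mono_of_nonneg (.of_forall fun _ => (Real.exp_pos _).le) hi
          (.of_forall fun ω => ?_)
        have h := exp_neg_le_quadratic (mul_nonneg hl (hY0 ω))
        simp only [neg_mul]
        refine h.trans (le_of_eq (by ring))
    _ = 1 - l * ∫ ω, Y ω ∂P + l ^ 2 / 2 * ∫ ω, Y ω ^ 2 ∂P := by
        rw [integral_add (f := fun ω => 1 - l * Y ω)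
          ((integrable_const _).sub (hY1.const_mul _)) (hY2.const_mul _),
          integral_sub (integrable_const _) (hY1.const_mul _), integral_const_mul,
          integral_const_mul]
        simp
    _ ≤ _ := by
        refine le_trans (le_of_eq ?_) (Real.add_one_le_exp _)
        ring

/-- Lower tail of a sum of independent copies of a nonnegative random variable. -/
theorem measure_sum_lt_half_le {Ω₀ Ω : Type*} [MeasurableSpace Ω₀] {P : Measure Ω₀}
    [IsProbabilityMeasure P] [MeasurableSpace Ω] {μ : Measure Ω} [IsProbabilityMeasure μ]
    {m : ℕ} {Y : Ω₀ → ℝ} {W : Fin m → Ω → ℝ} (hY0 : ∀ ω, 0 ≤ Y ω)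
    (hY2 : Integrable (fun ω => Y ω ^ 2) P) (hind : iIndepFun W μ)
    (hid : ∀ i, IdentDistrib (W i) Y μ P) {t K : ℝ} (ht : 0 < t) (hK : 0 < K)
    (hmean : ∫ ω, Y ω ∂P = t) (hsq : ∫ ω, Y ω ^ 2 ∂P ≤ K * t ^ 2) (hY : AEMeasurable Y P) :
    μ.real {ω | ∑ i, W i ω ≤ m / 2 * t} ≤ Real.exp (-(m / (8 * K))) := by
  -- This `l` minimizes the Chernoff exponent per term, `-lt/2 + l²Kt²/2`, with value `-1/(8K)`.
  set l := 1 / (2 * K * t) with hl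
  have hl0 : 0 < l := by positivity
  have hW : ∀ i, AEMeasurable (W i) μ := fun i => (hid i).aemeasurable_fst
  have hmgf : ∀ i, mgf (W i) μ (-l) ≤ Real.exp (-(3 / (8 * K))) := by
    intro i
    have : mgf (W i) μ (-l) = mgf Y P (-l) := by
      rw [mgf, mgf]
      exact ((hid i).comp (u := fun x => Real.exp (-l * x)) (by fun_prop)).integral_eq
    rw [this]
    refine (mgf_neg_le hY0 hY hY2 hl0.le).trans (Real.exp_le_exp.2 ?_)
    rw [hmean]
    have h1 : l ^ 2 / 2 * ∫ ω, Y ω ^ 2 ∂P ≤ l ^ 2 / 2 * (K * t ^ 2) :=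
      mul_le_mul_of_nonneg_left hsq (by positivity)
    have h2 : -(l * t) + l ^ 2 / 2 * (K * t ^ 2) = -(3 / (8 * K)) := by
      rw [hl]; field_simp; ring
    linarith
  have hsum : mgf (∑ i, W i) μ (-l) ≤ Real.exp (-(3 / (8 * K))) ^ m := by
    rw [hind.mgf_sum₀ hW]
    exact (Finset.prod_le_prod (fun i _ => mgf_nonneg) fun i _ => hmgf i).trans (by simp)
  have hW0 : ∀ᵐ ω ∂μ, ∀ i, 0 ≤ W i ω := by
    rw [ae_all_iff]
    intro i
    exact ((hid i).symm.ae_snd (p := fun x => 0 ≤ x) measurableSet_Ici (.of_forall hY0))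
  have hint : Integrable (fun ω => Real.exp (-l * (∑ i, W i) ω)) μ := by
    refine Integrable.of_bound (C := 1) ?_ ?_
    · exact (Real.measurable_exp.comp_aemeasurable
        ((Finset.aemeasurable_sum _ fun i _ => hW i).const_mul _)).aestronglyMeasurable
    · filter_upwards [hW0] with ω hω
      rw [Real.norm_of_nonneg (Real.exp_pos _).le, Real.exp_le_one_iff, Finset.sum_apply]
      have := Finset.sum_nonneg fun i (_ : i ∈ Finset.univ) => hω i
      nlinarith
  have h := measure_le_le_exp_mul_mgf (μ := μ) (X := ∑ i, W i) (t := -l) (m / 2 * t)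
    (by linarith) hint
  simp only [Finset.sum_apply] at h
  refine h.trans ((mul_le_mul_of_nonneg_left hsum (Real.exp_pos _).le).trans (le_of_eq ?_))
  rw [← Real.exp_nat_mul, ← Real.exp_add]
  congr 1
  rw [hl]; field_simp; ring

/-! ### From the finite net to the null space property. -/

section Ensemble

open scoped InnerProductSpace

variable {m n : ℕ}

/-- A lower bound for `‖A z‖` on averages of vertices implies the robust null space property. -/
theorem robustNSP_of_vertexAverage (hn : 1 ≤ n) (hm : 1 ≤ m) {a : Fin m → Vec n}
    (ha : ∀ i k, ‖a i k‖ ≤ 1) {s N : ℕ} (hs : 1 ≤ s) {ρ : ℝ} (hρ : 0 < ρ) (hρ1 : ρ < 1)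
    (hN : 7200 * s / ρ ^ 2 ≤ N)
    (hlow : ∀ f : Fin N → Fin n × Fin 4, m / 2 * ‖vertexAverage (2 * √(s : ℝ) / ρ) f‖ ^ 2 ≤
      ‖apply (measurementMatrix a) (vertexAverage (2 * √(s : ℝ) / ρ) f)‖ ^ 2) :
    RobustNSP s ρ (2 / √(m : ℝ)) (measurementMatrix a) := by
  intro z hz S hS
  by_contra! hcon
  have hs0 : (0 : ℝ) < s := by exact_mod_cast hs
  have hm0 : (0 : ℝ) < √(m : ℝ) := Real.sqrt_pos.2 (by exact_mod_cast hm)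
  have hmsq : √(m : ℝ) ^ 2 = m := Real.sq_sqrt (Nat.cast_nonneg _)
  have hs' : (0 : ℝ) < √(s : ℝ) := Real.sqrt_pos.2 hs0
  have hN0 : (0 : ℝ) < N := lt_of_lt_of_le (by positivity) hN
  have hS1 : ‖restrict S z‖ ≤ 1 := by
    refine abs_le_of_sq_le_sq' ?_ one_pos.le |>.2
    have := norm_restrict_sq_add_compl S z
    rw [hz] at this
    linarith [sq_nonneg ‖restrict Sᶜ z‖]
  have hl1 : l1norm z ≤ 2 * √(s : ℝ) / ρ := by
    have h1 := (l1norm_restrict_le_sqrt (hS.1.le.trans (min_le_left s n)) z)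
    have h2 : ρ / √(s : ℝ) * l1norm (restrict Sᶜ z) ≤ 1 := by
      have : 0 ≤ 2 / √(m : ℝ) * ‖apply (measurementMatrix a) z‖ := by positivity
      linarith
    have h3 : l1norm (restrict Sᶜ z) ≤ √(s : ℝ) / ρ := by
      rw [le_div_iff₀ hρ]
      rw [div_mul_eq_mul_div, div_le_one hs'] at h2
      linarith
    have h4 : √(s : ℝ) ≤ √(s : ℝ) / ρ := by
      rw [le_div_iff₀ hρ]; nlinarith
    rw [← l1norm_restrict_add_compl S z]
    have h5 : 2 * √(s : ℝ) / ρ = √(s : ℝ) / ρ + √(s : ℝ) / ρ := by ring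
    nlinarith
  obtain ⟨f, hf1, hf2⟩ := exists_vertexAverage_near hn hm ha hl1
    (N := N) (by exact_mod_cast hN0)
  have hf3 := hlow f
  set Z := vertexAverage (2 * √(s : ℝ) / ρ) f
  set A := measurementMatrix a
  -- `7200 = 100 · 18 · 4`, so both approximation errors are at most `1/10`, the second in units of
  -- `√m`.
  have hδ : 18 * (2 * √(s : ℝ) / ρ) ^ 2 / N ≤ 1 / 100 := by
    rw [div_le_iff₀ hN0, div_pow, mul_pow, Real.sq_sqrt hs0.le]
    have : 18 * (2 ^ 2 * (s : ℝ) / ρ ^ 2) = 1 / 100 * (7200 * s / ρ ^ 2) := by ring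
    rw [this]
    linarith
  have g1 : ‖Z - z‖ ≤ 1 / 10 :=
    abs_le_of_sq_le_sq' ((hf1.trans hδ).trans (by norm_num)) (by norm_num) |>.2
  have g2 : ‖apply A (Z - z)‖ ≤ √(m : ℝ) / 10 := by
    refine abs_le_of_sq_le_sq' ?_ (by positivity) |>.2
    rw [div_pow, hmsq]
    have := mul_le_mul_of_nonneg_left hδ (Nat.cast_nonneg (α := ℝ) m)
    linarith
  have g3 : 9 / 10 ≤ ‖Z‖ := by
    have := norm_sub_norm_le z (z - Z)
    rw [sub_sub_cancel, hz, norm_sub_rev] at this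
    linarith
  -- `(9/10)²/2 = 0.405 ≥ 0.36`.
  have g4 : 6 / 10 * √(m : ℝ) ≤ ‖apply A Z‖ := by
    refine abs_le_of_sq_le_sq' (le_trans ?_ hf3) (norm_nonneg _) |>.2
    rw [mul_pow, hmsq]
    have h := mul_le_mul_of_nonneg_left (pow_le_pow_left₀ (by norm_num) g3 2)
      (Nat.cast_nonneg (α := ℝ) m)
    linarith [Nat.cast_nonneg (α := ℝ) m]
  have g5 : √(m : ℝ) / 2 ≤ ‖apply A z‖ := by
    have : ‖apply A Z‖ ≤ ‖apply A (Z - z)‖ + ‖apply A z‖ := by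
      refine le_trans (le_of_eq ?_) (norm_add_le _ _)
      rw [apply_eq_toEuclideanLin, apply_eq_toEuclideanLin, apply_eq_toEuclideanLin, ← map_add,
        sub_add_cancel]
    linarith
  have g6 : 1 ≤ 2 / √(m : ℝ) * ‖apply A z‖ := by
    rw [div_mul_eq_mul_div, le_div_iff₀ hm0]; linarith
  have : 0 ≤ ρ / √(s : ℝ) * l1norm (restrict Sᶜ z) :=
    mul_nonneg (by positivity) (l1norm_nonneg _)
  linarith

/-- In dimension one, unimodular measurements have the robust null space property. -/
theorem robustNSP_of_dim_one (hm : 1 ≤ m) {a : Fin m → Vec 1} (ha : ∀ i, ‖a i 0‖ = 1)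
    {s : ℕ} (hs : 1 ≤ s) {ρ : ℝ} (hρ : 0 < ρ) :
    RobustNSP s ρ (2 / √(m : ℝ)) (measurementMatrix a) := by
  intro z hz S _
  have hm0 : (0 : ℝ) < √(m : ℝ) := Real.sqrt_pos.2 (by exact_mod_cast hm)
  have hz0 : ‖z 0‖ = 1 := by
    rw [EuclideanSpace.norm_eq] at hz
    simpa using hz
  have h1 : ‖apply (measurementMatrix a) z‖ = √(m : ℝ) := by
    rw [eq_comm, Real.sqrt_eq_iff_eq_sq (Nat.cast_nonneg _) (norm_nonneg _), norm_apply_sq]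
    simp [PiLp.inner_apply, ha, hz0]
  have hS1 : ‖restrict S z‖ ≤ 1 := by
    refine abs_le_of_sq_le_sq' ?_ one_pos.le |>.2
    have := norm_restrict_sq_add_compl S z
    rw [hz] at this
    linarith [sq_nonneg ‖restrict Sᶜ z‖]
  have : 0 ≤ ρ / √(s : ℝ) * l1norm (restrict Sᶜ z) :=
    mul_nonneg (by positivity) (l1norm_nonneg _)
  rw [h1, div_mul_cancel₀ _ hm0.ne']
  linarith

/-- The bad set need not be measurable, as the copies are only a.e. measurable; the complement of
its measurable hull serves as the good event. -/
theorem exists_measurableSet_of_measureReal_le {Ω : Type*} [MeasurableSpace Ω] {μ : Measure Ω}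
    [IsProbabilityMeasure μ] {B : Set Ω} {b : ℝ} (hB : μ.real B ≤ b) :
    ∃ E, MeasurableSet E ∧ 1 - b ≤ μ.real E ∧ ∀ ω ∈ E, ω ∉ B := by
  refine ⟨(toMeasurable μ B)ᶜ, (measurableSet_toMeasurable μ B).compl, ?_,
    fun ω hω hB => hω (subset_toMeasurable μ B hB)⟩
  rw [probReal_compl_eq_one_sub (measurableSet_toMeasurable μ B), measureReal_def,
    measure_toMeasurable, ← measureReal_def]
  linarith

/-! ### Random measurements and the union bound. -/

variable {Ω₀ Ω : Type*} [MeasurableSpace Ω₀] {P : Measure Ω₀} {a : Ω₀ → Vec n}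
  [MeasurableSpace Ω] {μ : Measure Ω} {X : Fin m → Ω → Vec n}

theorem Incoherent.ae_iSup_eq (hinc : Incoherent a P) (hid : ∀ i, IdentDistrib (X i) a μ P) :
    ∀ᵐ ω ∂μ, ∀ i, (⨆ k, ‖X i ω k‖ ^ 2) = 1 := by
  rw [ae_all_iff]
  intro i
  have hmeas : Measurable fun v : Vec n => ⨆ k, ‖v k‖ ^ 2 :=
    Measurable.iSup fun k => by fun_prop
  refine (hid i).symm.ae_snd (p := fun v : Vec n => (⨆ k, ‖v k‖ ^ 2) = 1)
    (hmeas (measurableSet_singleton 1)) ?_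
  filter_upwards [hinc] with ω hω
  simpa [EuclideanSpace.inner_single_left] using hω

variable [IsProbabilityMeasure P] [IsProbabilityMeasure μ]

/-- Lower tail of `‖A z‖ ^ 2` for a fixed vector `z`. -/
theorem measure_norm_apply_sq_lt_le {C₄ : ℝ} (hC : 0 < C₄) (ha : AEMeasurable a P)
    (hiso : Isotropic a P) (h4 : FourthMomentBound C₄ a P) (hind : iIndepFun X μ)
    (hid : ∀ i, IdentDistrib (X i) a μ P) (z : Vec n) :
    μ.real {ω | ‖apply (measurementMatrix fun i => X i ω) z‖ ^ 2 < m / 2 * ‖z‖ ^ 2} ≤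
      Real.exp (-(m / (8 * C₄))) := by
  rcases eq_or_ne z 0 with rfl | hz
  · have : {ω | ‖apply (measurementMatrix fun i => X i ω) (0 : Vec n)‖ ^ 2
        < m / 2 * ‖(0 : Vec n)‖ ^ 2} = ∅ := by
      ext ω
      simp [apply_eq_toEuclideanLin]
    rw [this, measureReal_empty]
    positivity
  have hg : Measurable fun b : Vec n => ‖⟪b, z⟫_ℂ‖ ^ 2 := by
    have : Continuous fun b : Vec n => ‖⟪b, z⟫_ℂ‖ ^ 2 := by fun_prop
    exact this.measurable
  have e4 : (fun ω => (‖⟪a ω, z⟫_ℂ‖ ^ 2) ^ 2) = fun ω => ‖⟪a ω, z⟫_ℂ‖ ^ 4 := by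
    ext ω; ring
  -- Isotropy gives the mean `‖z‖²` of `|⟪a, z⟫|²`; the fourth-moment bound controls its second
  -- moment.
  refine le_trans (measureReal_mono ?_) (measure_sum_lt_half_le (P := P) (μ := μ)
    (Y := fun ω => ‖⟪a ω, z⟫_ℂ‖ ^ 2) (W := fun i ω => ‖⟪X i ω, z⟫_ℂ‖ ^ 2) (t := ‖z‖ ^ 2)
    (K := C₄) (fun ω => by positivity) (e4 ▸ (h4 z).1)
    (hind.comp (fun _ b => ‖⟪b, z⟫_ℂ‖ ^ 2) fun _ => hg) (fun i => (hid i).comp hg)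
    (by positivity) hC (hiso z) ?_ (hg.comp_aemeasurable ha))
  · intro ω hω
    rw [Set.mem_ofPred_eq, norm_apply_sq] at hω
    exact hω.le
  · rw [e4]
    refine (h4 z).2.trans (le_of_eq (by ring))

theorem norm_le_one_of_iSup_eq {v : Vec n} (hv : (⨆ k, ‖v k‖ ^ 2) = 1) (k : Fin n) :
    ‖v k‖ ≤ 1 := by
  refine abs_le_of_sq_le_sq' ?_ one_pos.le |>.2
  rw [one_pow, ← hv]
  exact le_ciSup (f := fun k => ‖v k‖ ^ 2) (Set.finite_range _).bddAbove k

/-- `4n ≤ n³` for `n ≥ 2`. -/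
theorem log_four_mul_le (hn : 2 ≤ n) : Real.log (n * 4) ≤ 3 * Real.log n := by
  have hn' : (2 : ℝ) ≤ n := by exact_mod_cast hn
  rw [← Real.log_rpow (by linarith)]
  refine Real.log_le_log (by linarith) ?_
  norm_cast
  nlinarith [mul_le_mul hn hn (by norm_num) (by omega)]

/-- The robust null space property of incoherent isotropic measurements, outside of an event of
exponentially small probability. -/
theorem exists_measurableSet_robustNSP {C₄ : ℝ} (hC : 0 < C₄) (ha : AEMeasurable a P)
    (hiso : Isotropic a P) (hinc : Incoherent a P) (h4 : FourthMomentBound C₄ a P)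
    (hind : iIndepFun X μ) (hid : ∀ i, IdentDistrib (X i) a μ P) {ρ : ℝ} (hρ : 0 < ρ)
    (hρ1 : ρ < 1) {s : ℕ} (hn : 1 ≤ n) (hs : 1 ≤ s)
    (hm : 16 * 3 * 7201 * C₄ * ρ⁻¹ ^ 2 * s * Real.log n ≤ m) :
    ∃ E : Set Ω, MeasurableSet E ∧ 1 - 2 * Real.exp (-(1 / (16 * C₄) * m)) ≤ μ.real E ∧
      ∀ ω ∈ E, RobustNSP s ρ (2 / √(m : ℝ)) (measurementMatrix fun i => X i ω) := by
  rcases Nat.eq_zero_or_pos m with rfl | hm0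
  -- For `m = 0` the required probability is `-1`.
  · exact ⟨∅, .empty, by simp, by simp⟩
  set B₀ : Set Ω := {ω | ¬ ∀ i, (⨆ k, ‖X i ω k‖ ^ 2) = 1} with hB₀
  have hB₀0 : μ.real B₀ = 0 := by
    rw [measureReal_def, ae_iff.1 (hinc.ae_iSup_eq hid), ENNReal.toReal_zero]
  -- For `n = 1`, `log n = 0` makes the condition on `m` void, but incoherence forces unimodular
  -- measurements.
  rcases hn.eq_or_lt with rfl | hn2
  · obtain ⟨E, hE, hE1, hE2⟩ := exists_measurableSet_of_measureReal_le (μ := μ) (B := B₀)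
      (b := 2 * Real.exp (-(1 / (16 * C₄) * m))) (by rw [hB₀0]; positivity)
    refine ⟨E, hE, hE1, fun ω hω => robustNSP_of_dim_one hm0 (fun i => ?_) hs hρ⟩
    have h := hE2 ω hω
    rw [hB₀, Set.mem_ofPred_eq, not_not] at h
    have h' : ‖X i ω 0‖ ^ 2 = 1 := (ciSup_unique (s := fun k => ‖X i ω k‖ ^ 2)).symm.trans (h i)
    exact (pow_eq_one_iff_of_nonneg (norm_nonneg _) two_ne_zero).1 h'
  set N := ⌈7200 * (s : ℝ) / ρ ^ 2⌉₊ with hN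
  set G : (Fin N → Fin n × Fin 4) → Set Ω := fun f =>
    {ω | ‖apply (measurementMatrix fun i => X i ω) (vertexAverage (2 * √(s : ℝ) / ρ) f)‖ ^ 2
      < m / 2 * ‖vertexAverage (2 * √(s : ℝ) / ρ) f‖ ^ 2} with hG
  have hG1 : μ.real (⋃ f, G f) ≤ Real.exp (-(1 / (16 * C₄) * m)) := by
    have hn0 : (0 : ℝ) < n * 4 := by
      have : (0 : ℝ) < n := by exact_mod_cast hn
      positivity
    have hs1 : (1 : ℝ) ≤ s := by exact_mod_cast hs
    -- Rounding up costs at most `1 ≤ s/ρ²`.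
    have hNle : (N : ℝ) ≤ 7201 * s / ρ ^ 2 := by
      have h1 : 1 ≤ (s : ℝ) / ρ ^ 2 := by
        rw [le_div_iff₀ (by positivity)]; nlinarith
      have h2 := (Nat.ceil_lt_add_one (a := 7200 * (s : ℝ) / ρ ^ 2) (by positivity)).le
      have h3 : 7201 * (s : ℝ) / ρ ^ 2 = 7200 * s / ρ ^ 2 + s / ρ ^ 2 := by ring
      linarith
    have hlog : 0 ≤ Real.log n := Real.log_natCast_nonneg n
    -- The entropy of the net uses half of the exponent `m/(8C₄)`.
    have hexp : N * Real.log (n * 4) ≤ m / (16 * C₄) := by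
      rw [le_div_iff₀ (by positivity)]
      calc N * Real.log (n * 4) * (16 * C₄)
          ≤ 7201 * s / ρ ^ 2 * (3 * Real.log n) * (16 * C₄) := by
            refine mul_le_mul_of_nonneg_right ?_ (by positivity)
            exact mul_le_mul hNle (log_four_mul_le hn2) (Real.log_nonneg (by
              have : (1 : ℝ) ≤ n := by exact_mod_cast hn
              linarith)) (by positivity)
        _ = 16 * 3 * 7201 * C₄ * ρ⁻¹ ^ 2 * s * Real.log n := by
            rw [inv_pow]; ring
        _ ≤ m := hm
    calc μ.real (⋃ f, G f) ≤ ∑ f, μ.real (G f) := measureReal_iUnion_fintype_le _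
      _ ≤ ∑ _f : Fin N → Fin n × Fin 4, Real.exp (-(m / (8 * C₄))) :=
          Finset.sum_le_sum fun f _ => measure_norm_apply_sq_lt_le hC ha hiso h4 hind hid _
      _ = Real.exp (N * Real.log (n * 4)) * Real.exp (-(m / (8 * C₄))) := by
          rw [Real.exp_nat_mul, Real.exp_log hn0]
          simp
      _ ≤ Real.exp (-(1 / (16 * C₄) * m)) := by
          rw [← Real.exp_add]
          refine Real.exp_le_exp.2 ?_
          have : m / (8 * C₄) = m / (16 * C₄) + 1 / (16 * C₄) * m := by
            field_simp; norm_num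
          linarith
  obtain ⟨E, hE, hE1, hE2⟩ := exists_measurableSet_of_measureReal_le (μ := μ)
    (B := B₀ ∪ ⋃ f, G f) (b := 2 * Real.exp (-(1 / (16 * C₄) * m))) (by
      refine (measureReal_union_le _ _).trans ?_
      rw [hB₀0]
      linarith [Real.exp_pos (-(1 / (16 * C₄) * m))])
  refine ⟨E, hE, hE1, fun ω hω => ?_⟩
  have h := hE2 ω hω
  rw [Set.mem_union, not_or, hB₀, Set.mem_ofPred_eq, not_not] at h
  refine robustNSP_of_vertexAverage hn hm0 (fun i k => norm_le_one_of_iSup_eq (h.1 i) k) hs hρ hρ1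
    (N := N) (Nat.le_ceil _) fun f => ?_
  by_contra! hf
  exact h.2 (Set.mem_iUnion.2 ⟨f, hf⟩)

end Ensemble

end SparseRecovery

end

theorem theorem6 :
    ∃ K : ℝ, 0 < K ∧ ∃ D₁ D₂ : ℝ → ℝ,
      (∀ ρ : ℝ, 0 < ρ → ρ < 1 → 0 < D₁ ρ ∧ 0 < D₂ ρ) ∧
      ∀ C₄ : ℝ, 0 < C₄ → ∃ C : ℝ, 0 < C ∧ ∃ c : ℝ, 0 < c ∧
        ∀ (ρ : ℝ), 0 < ρ → ρ < 1 →
        ∀ (n m s : ℕ), 1 ≤ n → 1 ≤ s →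
        C * ρ⁻¹ ^ 2 * (s : ℝ) * Real.log (n : ℝ) ≤ (m : ℝ) →
        -- the random vector `a`
        ∀ (Ω₀ : Type*) [MeasurableSpace Ω₀] (P : Measure Ω₀) [IsProbabilityMeasure P]
          (a : Ω₀ → SparseRecovery.Vec n), AEMeasurable a P →
        SparseRecovery.Isotropic a P → SparseRecovery.Incoherent a P →
        SparseRecovery.FourthMomentBound C₄ a P →
        -- its `m` independent copies
        ∀ (Ω : Type*) [MeasurableSpace Ω] (μ : Measure Ω) [IsProbabilityMeasure μ]
          (X : Fin m → Ω → SparseRecovery.Vec n),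
        iIndepFun X μ → (∀ i, IdentDistrib (X i) a μ P) →
        ∃ E : Set Ω, MeasurableSet E ∧ 1 - 2 * Real.exp (-(c * m)) ≤ μ.real E ∧
          ∀ ω ∈ E,
            SparseRecovery.RobustNSP s ρ (K / √(m : ℝ))
              (SparseRecovery.measurementMatrix fun i => X i ω) ∧
            ∀ (x : SparseRecovery.Vec n) (e : SparseRecovery.Vec m) (η : ℝ), ‖e‖ ≤ η →
            ∀ zs : SparseRecovery.Vec n,
              SparseRecovery.IsBPDNSolution
                (SparseRecovery.measurementMatrix fun i => X i ω)
                (SparseRecovery.apply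
                  (SparseRecovery.measurementMatrix fun i => X i ω) x + e) η zs →
              ‖x - zs‖ ≤ D₁ ρ / √(s : ℝ) * SparseRecovery.sparseError s x
                + D₂ ρ * (η / √(m : ℝ)) := by
  -- The 4 in `D₂` comes from `τ · 2η` with `τ = 2/√m`.
  refine ⟨2, two_pos, fun ρ => 8 / (1 - ρ), fun ρ => 4 * (4 / (1 - ρ) + 3), ?_, ?_⟩
  · intro ρ _ h1
    have : 0 < 1 - ρ := by linarith
    constructor <;> positivity
  intro C₄ hC
  refine ⟨16 * 3 * 7201 * C₄, by positivity, 1 / (16 * C₄), by positivity, ?_⟩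
  intro ρ hρ hρ1 n m s hn hs hm Ω₀ _ P _ a ha hiso hinc h4 Ω _ μ _ X hind hid
  obtain ⟨E, hE, hE1, hE2⟩ := SparseRecovery.exists_measurableSet_robustNSP hC ha hiso hinc h4
    hind hid hρ hρ1 hn hs hm
  refine ⟨E, hE, hE1, fun ω hω => ⟨hE2 ω hω, fun x e η he zs hzs => ?_⟩⟩
  refine ((hE2 ω hω).bpdn_error_le hs hρ hρ1 (by positivity) he hzs).trans (le_of_eq ?_)
  ring
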